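/- \textbf{Setting.} A \emph{mixed preparation} on $\mathbb C^d$ is a finite convex decomposition $\rho=\sum_i p_i|\psi_i\rangle\langle\psi_i|$ into pure states (different decompositions of one density operator are different preparations). For preparations $\rho_1,\dots,\rho_n$, the \emph{anti-distinguishability} is $$A_Q^{[n]}=\frac1n\max_{\{E_k\}}\sum_{x=1}^n\sum_{k\neq x}\mathrm{Tr}(\rho_xE_k),$$ the maximum being over all $n$-outcome POVMs, and the \emph{common quantum overlap} is $\omega_Q^{[n]}=n(1-A_Q^{[n]})$. An \emph{ontological model} of quantum theory on $\mathbb C^d$ consists of a measurable space $\Lambda$, a probability distribution $\mu(\cdot|\psi)$ on $\Lambda$ for each pure state $\psi$, and for each POVM $\mathcal M=\{E_k\}$ measurable response functions $\xi(k|\mathcal M,\lambda)\ge 0$ with $\sum_k\xi(k|\mathcal M,\lambda)=1$, such that $\int_\Lambda\xi(k|\mathcal M,\lambda)\,d\mu(\lambda|\psi)=\langle\psi|E_k|\psi\rangle$. A preparation $\rho=\sum_ip_i|\psi_i\rangle\langle\psi_i|$ has epistemic state $\mu(\cdot|\rho)=\sum_ip_i\,\mu(\cdot|\psi_i)$, and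 the \emph{common epistemic overlap} is $$\omega_E^{[n]}(\rho_1,\dots,\rho_n)=\int_\Lambda\min\bigl(\mu(\lambda|\rho_1),\dots,\mu(\lambda|\rho_n)\bigr)\,d\lambda,$$ where the densities are taken with respect to any common dominating measure. Write $\omega_E,\omega_Q$ for $n=2$. A model is \emph{preparation noncontextual} if $\omega_Q(\rho,\sigma)=1$ implies $\mu(\cdot|\rho)=\mu(\cdot|\sigma)$ for all preparations $\rho,\sigma$. Two orthonormal bases $(e_i),(f_j)$ of $\mathbb C^d$ are \emph{mutually unbiased} if $|\langle e_i,f_j\rangle|^2=1/d$ for all $i,j$. \textbf{Theorem.} (1) Let $d\ge4$ be a prime power, let $\{\psi_i\}_{i=1}^d$ and $\{\phi_{i|k}\}_{i=1}^d$, $k=1,\dots,d$, be any $d+1$ pairwise mutually unbiased orthonormal bases (MUBs) of $\mathbb C^d$, and consider the preparations $$\rho_0=\frac1d\sum_{i=1}^d|\psi_i\rangle\langle\psi_i|,\qquad \rho_k=\frac1d\sum_{i=1}^d|\phi_{i|k}\rangle\langle\phi_{i|k}|\quad(1\le k\le d).$$ All of them have density operator $\mathbb 1/d$, and $\omega_Q(\rho_0,\rho_k)=1$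 for every $k$. For every ontological model of quantum theory on $\mathbb C^d$, $$\frac1d\sum_{k=1}^d\frac{\omega_E(\rho_0,\rho_k)}{\omega_Q(\rho_0,\rho_k)}\le\frac1d .$$ Moreover, for every such model there is a $k$ with $\omega_Q(\rho_0,\rho_k)=1$ and $\omega_E(\rho_0,\rho_k)<1$, and the model is not preparation noncontextual. (2) (Asymptotically fully non-epistemic pairs.) Let $(d_n)$ be a sequence of prime powers $d_n\ge4$ with $d_n\to\infty$ (for example $d_n=p^{n+2}$, $n\ge 0$, with $p$ a fixed prime). For each $n$ let $\rho^{(n)}_0,\dots,\rho^{(n)}_{d_n}$ be the preparations built as in (1) from $d_n+1$ MUBs of $\mathbb C^{d_n}$, and let an ontological model of quantum theory on $\mathbb C^{d_n}$ be given. Then there are indices $k_n\in\{1,\dots,d_n\}$ (which may depend on the bases and on the models) with $\omega_Q(\rho^{(n)}_0,\rho^{(n)}_{k_n})=1$ for all $n$, while $\omega_E(\rho^{(n)}_0,\rho^{(n)}_{k_n})\to0$, and hence also $\omega_E(\rho^{(n)}_0,\rho^{(n)}_{k_n})/\omega_Q(\rho^{(n)}_0,\rho^{(n)}_{k_n})\to0$,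 as $n\to\infty$. -/

import Mathlib

open MeasureTheory
open scoped ENNReal ComplexOrder

universe u

noncomputable section

namespace Quantum

/-- A pure state of `ℂ^d`, given by a unit vector.  (Epistemic states are attached to unit vectors,
which includes every model in which they depend on the ray only.) -/
def PureState (d : ℕ) : Type := {v : EuclideanSpace ℂ (Fin d) // ‖v‖ = 1}

/-- The projector `|ψ⟩⟨ψ|`. -/
def PureState.proj {d : ℕ} (ψ : PureState d) : Matrix (Fin d) (Fin d) ℂ :=
  Matrix.of fun i j => ψ.1 i * star (ψ.1 j)

/-- A quantum mixed preparation: a finite convex mixture of pure states.  Different decompositions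
of one density operator are different preparations. -/
structure MixedPreparation (d : ℕ) where
  size : ℕ
  weight : Fin size → ℝ
  state : Fin size → PureState d
  weight_nonneg : ∀ i, 0 ≤ weight i
  sum_weight : ∑ i, weight i = 1

/-- The density operator `∑ᵢ pᵢ |ψᵢ⟩⟨ψᵢ|` of a mixed preparation. -/
def MixedPreparation.density {d : ℕ} (P : MixedPreparation d) : Matrix (Fin d) (Fin d) ℂ :=
  ∑ i, (P.weight i : ℂ) • (P.state i).proj

/-- A measurement on `ℂ^d` with `n` outcomes. -/
structure POVM (d n : ℕ) where
  effect : Fin n → Matrix (Fin d) (Fin d) ℂ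
  posSemidef : ∀ k, (effect k).PosSemidef
  sum_effect : ∑ k, effect k = 1

/-- Born's rule: the probability `Tr (ρ E_k)` of outcome `k`. -/
def bornProb {d n : ℕ} (ρ : Matrix (Fin d) (Fin d) ℂ) (E : POVM d n) (k : Fin n) : ℝ :=
  (ρ * E.effect k).trace.re

/-- Anti-distinguishability of `n` preparations: the maximum over all `n`-outcome measurements of
the average probability that the outcome differs from the label of the preparation. -/
def antiDistinguishability {d n : ℕ} (P : Fin n → MixedPreparation d) : ℝ :=
  (1 / (n : ℝ)) *
    ⨆ E : POVM d n, ∑ x, ∑ k ∈ Finset.univ.filter (fun k => k ≠ x), bornProb (P x).density E k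

/-- Common quantum overlap of `n` preparations. -/
def quantumOverlap {d n : ℕ} (P : Fin n → MixedPreparation d) : ℝ :=
  (n : ℝ) * (1 - antiDistinguishability P)

/-- An ontological model of quantum theory on `ℂ^d`: an ontic state space, an epistemic state
(a probability distribution over ontic states) for each pure state, and a response scheme for each
measurement, which together reproduce Born's rule. -/
structure OntologicalModel (d : ℕ) where
  Ontic : Type u
  [measurableSpace : MeasurableSpace Ontic]
  epistemic : PureState d → Measure Ontic
  isProbabilityMeasure : ∀ ψ, IsProbabilityMeasure (epistemic ψ)
  response : ∀ {n : ℕ}, POVM d n → Fin n → Ontic → ℝ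
  measurable_response : ∀ {n : ℕ} (E : POVM d n) (k : Fin n), Measurable (response E k)
  response_nonneg : ∀ {n : ℕ} (E : POVM d n) (k : Fin n) (l : Ontic), 0 ≤ response E k l
  sum_response : ∀ {n : ℕ} (E : POVM d n) (l : Ontic), ∑ k, response E k l = 1
  born : ∀ {n : ℕ} (ψ : PureState d) (E : POVM d n) (k : Fin n),
    ∫ l, response E k l ∂(epistemic ψ) = bornProb ψ.proj E k

attribute [instance] OntologicalModel.measurableSpace OntologicalModel.isProbabilityMeasure

/-- The epistemic state of a mixed preparation is the corresponding convex mixture of the epistemic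
states of the pure states in its decomposition. -/
def OntologicalModel.mixedEpistemic {d : ℕ} (M : OntologicalModel.{u} d)
    (P : MixedPreparation d) : Measure M.Ontic :=
  ∑ i, ENNReal.ofReal (P.weight i) • M.epistemic (P.state i)

/-- The common overlap `∫ min(dμ₁, …, dμₙ)` of finitely many measures, computed with their
densities relative to the dominating measure `∑ⱼ μⱼ`.  The value is the same for densities
relative to any other common reference measure: see `commonOverlap_withDensity`. -/
def commonOverlap {X : Type u} [MeasurableSpace X] {n : ℕ} (μ : Fin n → Measure X) : ℝ≥0∞ :=
  ∫⁻ x, ⨅ i, (μ i).rnDeriv (∑ j, μ j) x ∂(∑ j, μ j)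

theorem commonOverlap_withDensity {X : Type u} [MeasurableSpace X] {n : ℕ} [NeZero n]
    (m : Measure X) (f : Fin n → X → ℝ≥0∞) (hf : ∀ i, Measurable (f i))
    (hfin : ∀ i, ∫⁻ x, f i x ∂m ≠ ∞) :
    commonOverlap (fun i => m.withDensity (f i)) = ∫⁻ x, ⨅ i, f i x ∂m := by
  have := fun i => isFiniteMeasure_withDensity (hfin i)
  set F : X → ℝ≥0∞ := fun x => ∑ i, f i x with hF
  have hFm : Measurable F := Finset.measurable_fun_sum _ fun i _ => hf i
  have hFint : ∫⁻ x, F x ∂m ≠ ∞ := by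
    rw [hF, lintegral_finsetSum _ fun i _ => hf i]
    exact ENNReal.sum_ne_top.2 fun i _ => hfin i
  have hsum : ∑ j, m.withDensity (f j) = m.withDensity F := by
    ext s hs
    rw [withDensity_apply _ hs, hF, lintegral_finsetSum _ fun i _ => hf i,
      Measure.finsetSum_apply]
    exact Finset.sum_congr rfl fun i _ => withDensity_apply _ hs
  have : IsFiniteMeasure (m.withDensity F) := isFiniteMeasure_withDensity hFint
  have hFtop : ∀ᵐ x ∂m, F x ≠ ∞ := (ae_lt_top hFm hFint).mono fun x hx => hx.ne
  have hle : ∀ i x, f i x ≤ F x := fun i x =>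
    Finset.single_le_sum (f := fun i => f i x) (fun _ _ => zero_le) (Finset.mem_univ i)
  have hmul : ∀ i x, F x ≠ ∞ → F x * (f i x / F x) = f i x := by
    intro i x hx
    by_cases h0 : F x = 0
    · have : f i x = 0 := le_antisymm (h0 ▸ hle i x) zero_le
      simp [h0, this]
    · exact ENNReal.mul_div_cancel h0 hx
  have hgm : ∀ i, Measurable fun x => f i x / F x := fun i => (hf i).div hFm
  have hd : ∀ i, (m.withDensity (f i)).rnDeriv (m.withDensity F)
      =ᵐ[m.withDensity F] fun x => f i x / F x := by
    intro i
    have : m.withDensity (f i) = (m.withDensity F).withDensity (fun x => f i x / F x) := by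
      rw [← withDensity_mul _ hFm (hgm i)]
      exact withDensity_congr_ae (hFtop.mono fun x hx => (hmul i x hx).symm)
    rw [this]
    exact Measure.rnDeriv_withDensity _ (hgm i)
  unfold commonOverlap
  rw [hsum]
  have h1 : (fun x => ⨅ i, (m.withDensity (f i)).rnDeriv (m.withDensity F) x)
      =ᵐ[m.withDensity F] fun x => ⨅ i, f i x / F x := by
    filter_upwards [ae_all_iff.2 hd] with x hx
    simp only [hx]
  rw [lintegral_congr_ae h1,
    lintegral_withDensity_eq_lintegral_mul _ hFm (Measurable.iInf hgm)]
  refine lintegral_congr_ae (hFtop.mono fun x hx => ?_)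
  simp only [Pi.mul_apply]
  rw [ENNReal.mul_iInf' (by simp [hx]) (fun _ => inferInstance)]
  exact iInf_congr fun i => hmul i x hx

/-- Common epistemic overlap of `n` preparations in an ontological model. -/
def OntologicalModel.epistemicOverlap {d n : ℕ} (M : OntologicalModel.{u} d)
    (P : Fin n → MixedPreparation d) : ℝ :=
  (commonOverlap fun x => M.mixedEpistemic (P x)).toReal

/-- Preparation noncontextuality: indistinguishable mixed preparations have the same
epistemic state. -/
def OntologicalModel.IsPreparationNoncontextual {d : ℕ} (M : OntologicalModel.{u} d) : Prop :=
  ∀ P Q : MixedPreparation d, quantumOverlap ![P, Q] = 1 → M.mixedEpistemic P = M.mixedEpistemic Q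

/-- Two orthonormal bases of `ℂ^d` are mutually unbiased if `|⟨eᵢ, fⱼ⟩|² = 1/d` for all `i, j`. -/
def MutuallyUnbiased {d : ℕ}
    (e f : OrthonormalBasis (Fin d) ℂ (EuclideanSpace ℂ (Fin d))) : Prop :=
  ∀ i j, ‖inner ℂ (e i) (f j)‖ ^ 2 = 1 / (d : ℝ)

/-- The preparation `(1/d) ∑ᵢ |eᵢ⟩⟨eᵢ|`: the equal mixture of the members of an orthonormal basis
of `ℂ^d`. -/
def uniformPreparation {d : ℕ} (hd : 0 < d)
    (e : OrthonormalBasis (Fin d) ℂ (EuclideanSpace ℂ (Fin d))) : MixedPreparation d where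
  size := d
  weight _ := 1 / (d : ℝ)
  state i := ⟨e i, e.orthonormal.1 i⟩
  weight_nonneg _ := by positivity
  sum_weight := by
    have : (d : ℝ) ≠ 0 := by positivity
    simp [this]

end Quantum

end

namespace Quantum

/-! Take one vector from each of three of the bases. Their pairwise overlaps are `1/d ≤ 1/4`, which
is small enough for a three-outcome measurement in which outcome `k` never occurs on the `k`-th
vector (`exists_antidistinguishing_povm`). In an ontological model an ontic state in the support of
all three would give every outcome probability zero, so almost no such state exists
(`ae_exists_density_eq_zero`). The support of a mixture is the union of the supports of its
components. Hence almost every ontic state in the support of `ρ₀` lies in the support of at most one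
other `ρ_k`, and `∑ₖ min(μ₀, μ_k) ≤ μ₀` pointwise (`sum_min_le_of_pairwise`). Integrating, the `d`
overlaps with `ρ₀` sum to at most `1`. Some overlap is therefore at most `1/d`, although every
quantum overlap is `1` because the density operators coincide. -/

/-! ### Antidistinguishing three vectors with small overlaps. -/

/-- Equal Gram matrices give `∑ xᵢvᵢ` and `∑ xᵢwᵢ` the same norm, so sending one to the other is a
well-defined isometry on the span of `v`. Finite dimension lets it extend to the whole space. -/
theorem exists_linearIsometryEquiv_of_inner_eq {ι E : Type*} [Fintype ι]
    [NormedAddCommGroup E] [InnerProductSpace ℂ E] [FiniteDimensional ℂ E] (v w : ι → E)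
    (h : ∀ i j, inner ℂ (v i) (v j) = inner ℂ (w i) (w j)) :
    ∃ U : E ≃ₗᵢ[ℂ] E, ∀ i, U (v i) = w i := by
  classical
  let A : (ι → ℂ) →ₗ[ℂ] E := Fintype.linearCombination ℂ v
  let B : (ι → ℂ) →ₗ[ℂ] E := Fintype.linearCombination ℂ w
  have hAB : ∀ x, ‖A x‖ = ‖B x‖ := by
    intro x
    have : inner ℂ (A x) (A x) = inner ℂ (B x) (B x) := by
      simp only [A, B, Fintype.linearCombination_apply, sum_inner, inner_sum, inner_smul_left,
        inner_smul_right, h]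
    rw [inner_self_eq_norm_sq_to_K, inner_self_eq_norm_sq_to_K] at this
    have h2 : ‖A x‖ ^ 2 = ‖B x‖ ^ 2 := by exact_mod_cast this
    exact (sq_eq_sq₀ (norm_nonneg _) (norm_nonneg _)).1 h2
  obtain ⟨g, hg⟩ := A.rangeRestrict.exists_rightInverse_of_surjective A.range_rangeRestrict
  have hg' : ∀ y, A (g y) = y := fun y => congrArg Subtype.val (LinearMap.congr_fun hg y)
  let L : LinearMap.range A →ₗᵢ[ℂ] E :=
    { toLinearMap := B ∘ₗ g
      norm_map' := fun y => by
        change ‖B (g y)‖ = ‖y‖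
        rw [← hAB, hg']
        rfl }
  refine ⟨L.extend.toLinearIsometryEquiv rfl, fun i => ?_⟩
  have hA : A (Pi.single i 1) = v i := by simp [A, Fintype.linearCombination_apply_single]
  have hB : B (Pi.single i 1) = w i := by simp [B, Fintype.linearCombination_apply_single]
  let y : LinearMap.range A := ⟨v i, Pi.single i 1, hA⟩
  have h1 : L.extend (y : E) = L y := L.extend_apply y
  -- The coefficients `g y` need not be `Pi.single i 1`, but the difference lies in the kernel of
  -- `A`, which is that of `B` because the norms agree.
  have h2 : B (g y) - B (Pi.single i 1) = 0 := by
    rw [← map_sub, ← norm_eq_zero, ← hAB, map_sub, hg', hA]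
    simp [y]
  change L.extend (y : E) = w i
  rw [h1, ← hB]
  exact sub_eq_zero.1 h2

/-- Solve `(a + b)² = 1 + 2c` and `(a - b)² = 1 - 2c`; the second needs `c ≤ 1/2`. With `c = 1/√d`
this is the condition `d ≥ 4`. -/
theorem exists_sq_add_sq_eq_one_mul_eq {c : ℝ} (hc0 : 0 ≤ c) (hc : c ≤ 1 / 2) :
    ∃ a b : ℝ, a ^ 2 + b ^ 2 = 1 ∧ a * b = c := by
  have h1 := Real.sq_sqrt (show 0 ≤ 1 + 2 * c by linarith)
  have h2 := Real.sq_sqrt (show 0 ≤ 1 - 2 * c by linarith)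
  refine ⟨(√(1 + 2 * c) + √(1 - 2 * c)) / 2, (√(1 + 2 * c) - √(1 - 2 * c)) / 2, ?_, ?_⟩
  · linear_combination (h1 + h2) / 2
  · linear_combination (h1 - h2) / 4

theorem inner_toLp_cons {m : ℕ} (x₀ x₁ x₂ y₀ y₁ y₂ : ℂ) :
    inner ℂ (WithLp.toLp 2 (Fin.cons x₀ (Fin.cons x₁ (Fin.cons x₂ 0))) :
        EuclideanSpace ℂ (Fin (m + 1 + 1 + 1)))
      (WithLp.toLp 2 (Fin.cons y₀ (Fin.cons y₁ (Fin.cons y₂ 0)))) =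
    (starRingEnd ℂ) x₀ * y₀ + (starRingEnd ℂ) x₁ * y₁ + (starRingEnd ℂ) x₂ * y₂ := by
  simp only [PiLp.inner_apply, Fin.sum_univ_succ, Fin.cons_zero, Fin.cons_succ, Pi.zero_apply,
    RCLike.inner_apply, zero_mul, Finset.sum_const_zero]
  ring

/-- Three unit vectors with pairwise overlaps `1/d ≤ 1/4` are orthogonal to complementary blocks
of some orthonormal basis. -/
theorem exists_basis_antidistinguishing {d : ℕ} (hd : 4 ≤ d)
    (v : Fin 3 → EuclideanSpace ℂ (Fin d)) (hv : ∀ i, ‖v i‖ = 1)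
    (h : ∀ i j, i ≠ j → ‖inner ℂ (v i) (v j)‖ ^ 2 = 1 / (d : ℝ)) :
    ∃ (u : OrthonormalBasis (Fin d) ℂ (EuclideanSpace ℂ (Fin d))) (c : Fin d → Fin 3),
      ∀ i, inner ℂ (u i) (v (c i)) = 0 := by
  obtain ⟨m, rfl⟩ : ∃ m, d = m + 1 + 1 + 1 := ⟨d - 3, by omega⟩
  set s : ℝ := √(1 / ((m + 1 + 1 + 1 : ℕ) : ℝ)) with hs
  have hdpos : (0 : ℝ) < 1 / ((m + 1 + 1 + 1 : ℕ) : ℝ) := by positivity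
  have hs0 : 0 < s := Real.sqrt_pos.2 hdpos
  have hs2 : s ^ 2 = 1 / ((m + 1 + 1 + 1 : ℕ) : ℝ) := Real.sq_sqrt hdpos.le
  have hsle : s ≤ 1 / 2 := by
    have : (4 : ℝ) ≤ ((m + 1 + 1 + 1 : ℕ) : ℝ) := by exact_mod_cast hd
    have h4 : 1 / ((m + 1 + 1 + 1 : ℕ) : ℝ) ≤ 1 / 4 := one_div_le_one_div_of_le (by norm_num) this
    nlinarith
  obtain ⟨a, b, hab, hmul⟩ := exists_sq_add_sq_eq_one_mul_eq hs0.le hsle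
  have key : ∀ i j, i ≠ j → ∃ p : ℂ, (starRingEnd ℂ) p * p = 1 ∧
      inner ℂ (v i) (v j) = (a : ℂ) * b * p := by
    intro i j hij
    have hn : ‖inner ℂ (v i) (v j)‖ = s := by
      rw [← sq_eq_sq₀ (norm_nonneg _) hs0.le, hs2, h i j hij]
    have hsC : (s : ℂ) ≠ 0 := by exact_mod_cast hs0.ne'
    refine ⟨inner ℂ (v i) (v j) / s, ?_, ?_⟩
    · rw [Complex.conj_mul', norm_div, hn, Complex.norm_real, Real.norm_of_nonneg hs0.le,
        div_self hs0.ne']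
      simp
    · rw [← Complex.ofReal_mul, hmul, mul_div_cancel₀ _ hsC]
  obtain ⟨p, hp, hp'⟩ := key 0 1 (by decide)
  obtain ⟨q, hq, hq'⟩ := key 1 2 (by decide)
  obtain ⟨r, hr, hr'⟩ := key 0 2 (by decide)
  have habC : (a : ℂ) ^ 2 + (b : ℂ) ^ 2 = 1 := by exact_mod_cast hab
  -- Model vectors: `w i` vanishes at coordinate `i`, has norm `a² + b² = 1`, and shares a single
  -- nonzero coordinate with each other one. That coordinate yields the modulus `ab`, and the phases
  -- `p`, `q`, `r` reproduce the Gram matrix of `v`.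
  let w : Fin 3 → EuclideanSpace ℂ (Fin (m + 1 + 1 + 1)) :=
    ![WithLp.toLp 2 (Fin.cons 0 (Fin.cons (a : ℂ) (Fin.cons (b : ℂ) 0))),
      WithLp.toLp 2 (Fin.cons (b : ℂ) (Fin.cons 0 (Fin.cons (a * p : ℂ) 0))),
      WithLp.toLp 2 (Fin.cons (a * q : ℂ) (Fin.cons (b * r : ℂ) (Fin.cons 0 0)))]
  have hle : ∀ i j : Fin 3, i ≤ j → inner ℂ (v i) (v j) = inner ℂ (w i) (w j) := by
    have hself : ∀ i, inner ℂ (v i) (v i) = (1 : ℂ) := fun i => by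
      rw [inner_self_eq_norm_sq_to_K, hv i]; simp
    intro i j hij
    fin_cases i <;> fin_cases j <;> first | (exact absurd hij (by decide)) | skip
    all_goals
      simp only [Fin.zero_eta, Fin.mk_one, Fin.reduceFinMk, hself, hp', hq', hr', w,
        Matrix.cons_val_zero, Matrix.cons_val_one, Matrix.cons_val, inner_toLp_cons, map_mul,
        map_zero, Complex.conj_ofReal]
    · linear_combination -habC
    · ring
    · ring
    · linear_combination -habC - (a : ℂ) ^ 2 * hp
    · ring
    · linear_combination -habC - (a : ℂ) ^ 2 * hq - (b : ℂ) ^ 2 * hr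
  have hin : ∀ i j : Fin 3, inner ℂ (v i) (v j) = inner ℂ (w i) (w j) := by
    intro i j
    rcases le_total i j with hij | hij
    · exact hle i j hij
    · rw [← inner_conj_symm, hle j i hij, inner_conj_symm]
  obtain ⟨U, hU⟩ := exists_linearIsometryEquiv_of_inner_eq v w hin
  -- Pull the standard basis back along `U`. All coordinates from `2` on can go to outcome `2`,
  -- since `w 2` vanishes there.
  refine ⟨(EuclideanSpace.basisFun _ ℂ).map U.symm,
    Fin.cons 0 (Fin.cons 1 fun _ => 2), fun i => ?_⟩
  rw [OrthonormalBasis.map_apply, ← U.inner_map_map, U.apply_symm_apply, hU,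
    EuclideanSpace.basisFun_apply, EuclideanSpace.inner_single_left]
  refine Fin.cases ?_ (fun i => Fin.cases ?_ (fun i => Fin.cases ?_ (fun i => ?_) i) i) i <;>
    simp only [w, Fin.cons_zero, Fin.cons_succ, Matrix.cons_val_zero, Matrix.cons_val_one,
      Matrix.cons_val, Pi.zero_apply, mul_zero]

/-! ### Measurements from bases, and the quantum overlap. -/

theorem sum_proj_orthonormalBasis {d : ℕ}
    (u : OrthonormalBasis (Fin d) ℂ (EuclideanSpace ℂ (Fin d))) :
    ∑ i, PureState.proj ⟨u i, u.orthonormal.1 i⟩ = 1 := by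
  ext k l
  have := u.sum_inner_mul_inner (EuclideanSpace.single k (1 : ℂ)) (EuclideanSpace.single l 1)
  simp only [EuclideanSpace.inner_single_left, EuclideanSpace.inner_single_right, map_one,
    one_mul] at this
  rw [Matrix.sum_apply]
  simp only [PureState.proj, Matrix.of_apply]
  refine this.trans ?_
  simp [Matrix.one_apply, eq_comm]

theorem PureState.proj_eq_vecMulVec {d : ℕ} (ψ : PureState d) :
    ψ.proj = Matrix.vecMulVec (ψ.1 : Fin d → ℂ) (star (ψ.1 : Fin d → ℂ)) := rfl

theorem PureState.posSemidef_proj {d : ℕ} (ψ : PureState d) : ψ.proj.PosSemidef := by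
  rw [ψ.proj_eq_vecMulVec]
  exact Matrix.posSemidef_vecMulVec_self_star _

/-- The coarse graining along `c` of the measurement in the orthonormal basis `u`. -/
noncomputable def POVM.ofBasis {d n : ℕ} (u : OrthonormalBasis (Fin d) ℂ (EuclideanSpace ℂ (Fin d)))
    (c : Fin d → Fin n) : POVM d n where
  effect k := ∑ i with c i = k, PureState.proj ⟨u i, u.orthonormal.1 i⟩
  posSemidef k := Matrix.posSemidef_sum _ fun i _ => PureState.posSemidef_proj _
  sum_effect := by
    rw [Finset.sum_fiberwise]
    exact sum_proj_orthonormalBasis u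

theorem proj_mul_proj_trace_eq_zero {d : ℕ} (ψ φ : PureState d) (h : inner ℂ φ.1 ψ.1 = (0 : ℂ)) :
    (ψ.proj * φ.proj).trace = 0 := by
  have h0 : star (φ.1 : Fin d → ℂ) ⬝ᵥ (ψ.1 : Fin d → ℂ) = 0 := by
    rw [dotProduct_comm]
    simpa [EuclideanSpace.inner_eq_star_dotProduct] using h
  rw [Matrix.trace_mul_comm, ψ.proj_eq_vecMulVec, φ.proj_eq_vecMulVec,
    Matrix.vecMulVec_mul_vecMulVec, h0]
  simp

theorem exists_antidistinguishing_povm {d : ℕ} (hd : 4 ≤ d) (v : Fin 3 → PureState d)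
    (h : ∀ i j, i ≠ j → ‖inner ℂ (v i).1 (v j).1‖ ^ 2 = 1 / (d : ℝ)) :
    ∃ E : POVM d 3, ∀ k, bornProb (v k).proj E k = 0 := by
  obtain ⟨u, c, huc⟩ := exists_basis_antidistinguishing hd (fun i => (v i).1) (fun i => (v i).2) h
  refine ⟨POVM.ofBasis u c, fun k => ?_⟩
  simp only [bornProb, POVM.ofBasis, Finset.mul_sum, Matrix.trace_sum]
  rw [Finset.sum_eq_zero, Complex.zero_re]
  intro i hi
  rw [Finset.mem_filter] at hi
  refine proj_mul_proj_trace_eq_zero _ _ ?_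
  rw [← hi.2]
  exact huc i

theorem uniformPreparation_density {d : ℕ} (hd : 0 < d)
    (e : OrthonormalBasis (Fin d) ℂ (EuclideanSpace ℂ (Fin d))) :
    (uniformPreparation hd e).density = (1 / (d : ℂ)) • (1 : Matrix (Fin d) (Fin d) ℂ) := by
  rw [← sum_proj_orthonormalBasis e, Finset.smul_sum]
  simp only [MixedPreparation.density, uniformPreparation]
  exact Finset.sum_congr rfl fun i _ => by push_cast; rfl

theorem sum_bornProb {d n : ℕ} (ρ : Matrix (Fin d) (Fin d) ℂ) (E : POVM d n) :
    ∑ k, bornProb ρ E k = ρ.trace.re := by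
  simp only [bornProb]
  rw [← Complex.re_sum, ← Matrix.trace_sum, ← Finset.mul_sum, E.sum_effect, mul_one]

/-- Both densities are `1/d` times the identity, so for two outcomes the sum being maximized is a
total probability, equal to `1` for every measurement. -/
theorem quantumOverlap_uniformPreparation {d : ℕ} (hd : 0 < d)
    (e f : OrthonormalBasis (Fin d) ℂ (EuclideanSpace ℂ (Fin d))) :
    quantumOverlap ![uniformPreparation hd e, uniformPreparation hd f] = 1 := by
  have hd' : (d : ℂ) ≠ 0 := by exact_mod_cast hd.ne'
  have : Nonempty (POVM d 2) := ⟨POVM.ofBasis e fun _ => 0⟩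
  have hE : ∀ E : POVM d 2, (∑ x, ∑ k ∈ Finset.univ.filter (fun k => k ≠ x),
      bornProb (![uniformPreparation hd e, uniformPreparation hd f] x).density E k) = 1 := by
    intro E
    have h := sum_bornProb ((1 / (d : ℂ)) • (1 : Matrix (Fin d) (Fin d) ℂ)) E
    have h1 : ((1 / (d : ℂ)) • (1 : Matrix (Fin d) (Fin d) ℂ)).trace.re = 1 := by
      simp [Matrix.trace_smul, hd']
    rw [h1, Fin.sum_univ_two] at h
    have f0 : Finset.univ.filter (fun k : Fin 2 => k ≠ 0) = {1} := by decide
    have f1 : Finset.univ.filter (fun k : Fin 2 => k ≠ 1) = {0} := by decide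
    rw [Fin.sum_univ_two, f0, f1]
    simp only [Finset.sum_singleton, Matrix.cons_val_zero, Matrix.cons_val_one,
      uniformPreparation_density]
    linarith
  rw [quantumOverlap, antiDistinguishability]
  simp only [hE, ciSup_const]
  norm_num

/-! ### Epistemic overlaps in an ontological model. -/

theorem OntologicalModel.ae_exists_density_eq_zero {d n : ℕ} (M : OntologicalModel.{u} d)
    (v : Fin n → PureState d) (E : POVM d n) (hE : ∀ k, bornProb (v k).proj E k = 0)
    (ν : Measure M.Ontic) (f : Fin n → M.Ontic → ℝ≥0∞) (hf : ∀ k, Measurable (f k))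
    (hν : ∀ k, M.epistemic (v k) = ν.withDensity (f k)) :
    ∀ᵐ x ∂ν, ∃ k, f k x = 0 := by
  have h : ∀ k, ∀ᵐ x ∂ν, f k x ≠ 0 → M.response E k x = 0 := by
    intro k
    rw [← ae_withDensity_iff (hf k), ← hν k]
    have hle : ∀ x, M.response E k x ≤ 1 := fun x => by
      rw [← M.sum_response E x]
      exact Finset.single_le_sum (f := fun k => M.response E k x)
        (fun k _ => M.response_nonneg E k x) (Finset.mem_univ k)
    -- Needed because the Bochner integral of a non-integrable function is `0` by convention.
    have hint : Integrable (M.response E k) (M.epistemic (v k)) :=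
      Integrable.of_bound (M.measurable_response E k).aestronglyMeasurable 1
        (.of_forall fun x => by
          rw [Real.norm_of_nonneg (M.response_nonneg E k x)]
          exact hle x)
    have h0 := (M.born (v k) E k).trans (hE k)
    exact (integral_eq_zero_iff_of_nonneg (M.response_nonneg E k) hint).1 h0
  filter_upwards [ae_all_iff.2 h] with x hx
  by_contra! hne
  have hsum := M.sum_response E x
  rw [Finset.sum_eq_zero fun k _ => hx k (hne k)] at hsum
  exact zero_ne_one hsum

/-- At most one term of the sum is nonzero, and each term is at most `g`. -/
theorem sum_min_le_of_pairwise {ι : Type*} [Fintype ι] (g : ℝ≥0∞) (f : ι → ℝ≥0∞)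
    (h : ∀ a b, a ≠ b → g = 0 ∨ f a = 0 ∨ f b = 0) : ∑ a, min g (f a) ≤ g := by
  by_cases hz : ∀ a, min g (f a) = 0
  · simp [hz]
  push Not at hz
  obtain ⟨a, ha⟩ := hz
  rw [Finset.sum_eq_single_of_mem a (Finset.mem_univ a)]
  · exact min_le_left _ _
  intro b _ hba
  have hg : g ≠ 0 := fun h0 => ha (by simp [h0])
  have hfa : f a ≠ 0 := fun h0 => ha (by simp [h0])
  have hfb : f b = 0 := ((h a b hba.symm).resolve_left hg).resolve_left hfa
  simp [hfb]

theorem mixedEpistemic_uniformPreparation {d : ℕ} (hd : 0 < d) (M : OntologicalModel.{u} d)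
    (e : OrthonormalBasis (Fin d) ℂ (EuclideanSpace ℂ (Fin d))) (ν : Measure M.Ontic)
    (f : Fin d → M.Ontic → ℝ≥0∞) (hf : ∀ i, Measurable (f i))
    (hν : ∀ i, M.epistemic ⟨e i, e.orthonormal.1 i⟩ = ν.withDensity (f i)) :
    M.mixedEpistemic (uniformPreparation hd e) =
      ν.withDensity fun x => ∑ i, ENNReal.ofReal (1 / (d : ℝ)) * f i x := by
  ext s hs
  rw [withDensity_apply _ hs, lintegral_finsetSum _ fun i _ => (hf i).const_mul _,
    OntologicalModel.mixedEpistemic, Measure.finsetSum_apply]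
  refine Finset.sum_congr rfl fun i _ => ?_
  rw [lintegral_const_mul _ (hf i), ← withDensity_apply _ hs, ← hν i]
  rfl

theorem OntologicalModel.isProbabilityMeasure_mixedEpistemic {d : ℕ} (M : OntologicalModel.{u} d)
    (P : MixedPreparation d) : IsProbabilityMeasure (M.mixedEpistemic P) := by
  constructor
  rw [mixedEpistemic, Measure.finsetSum_apply]
  simp only [Measure.smul_apply, measure_univ, smul_eq_mul, mul_one]
  rw [← ENNReal.ofReal_sum_of_nonneg fun i _ => P.weight_nonneg i, P.sum_weight,
    ENNReal.ofReal_one]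

theorem sum_commonOverlap_le_one {d : ℕ} (hd : 4 ≤ d)
    (B : Fin (d + 1) → OrthonormalBasis (Fin d) ℂ (EuclideanSpace ℂ (Fin d)))
    (hB : Pairwise fun a b => MutuallyUnbiased (B a) (B b)) (M : OntologicalModel.{u} d)
    (hd' : 0 < d) :
    ∑ k : Fin d, commonOverlap (fun x => M.mixedEpistemic
      (![uniformPreparation hd' (B 0), uniformPreparation hd' (B k.succ)] x)) ≤ 1 := by
  let ψ : Fin (d + 1) → Fin d → PureState d := fun a i => ⟨B a i, (B a).orthonormal.1 i⟩
  -- One reference measure dominates all the epistemic states involved, so their densities can be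
  -- compared pointwise.
  let ν : Measure M.Ontic := ∑ a, ∑ i, M.epistemic (ψ a i)
  let f : Fin (d + 1) → Fin d → M.Ontic → ℝ≥0∞ := fun a i => (M.epistemic (ψ a i)).rnDeriv ν
  have hf : ∀ a i, Measurable (f a i) := fun a i => Measure.measurable_rnDeriv _ _
  have hν : ∀ a i, M.epistemic (ψ a i) = ν.withDensity (f a i) := by
    intro a i
    refine (Measure.withDensity_rnDeriv_eq _ _ (Measure.absolutelyContinuous_of_le ?_)).symm
    exact (Finset.single_le_sum (f := fun i => M.epistemic (ψ a i)) (fun _ _ => Measure.zero_le _)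
      (Finset.mem_univ i)).trans (Finset.single_le_sum
        (f := fun a => ∑ i, M.epistemic (ψ a i)) (fun _ _ => Measure.zero_le _) (Finset.mem_univ a))
  let F : Fin (d + 1) → M.Ontic → ℝ≥0∞ :=
    fun a x => ∑ i, ENNReal.ofReal (1 / (d : ℝ)) * f a i x
  have hF : ∀ a, Measurable (F a) := fun a =>
    Finset.measurable_fun_sum _ fun i _ => (hf a i).const_mul _
  have hmix : ∀ a, M.mixedEpistemic (uniformPreparation hd' (B a)) = ν.withDensity (F a) :=
    fun a => mixedEpistemic_uniformPreparation hd' M (B a) ν (f a) (hf a) (hν a)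
  have hF1 : ∀ a, ∫⁻ x, F a x ∂ν = 1 := by
    intro a
    have := (M.isProbabilityMeasure_mixedEpistemic (uniformPreparation hd' (B a))).measure_univ
    rwa [hmix, withDensity_apply _ .univ, Measure.restrict_univ] at this
  have hov : ∀ k : Fin d, commonOverlap (fun x => M.mixedEpistemic
      (![uniformPreparation hd' (B 0), uniformPreparation hd' (B k.succ)] x)) =
      ∫⁻ x, min (F 0 x) (F k.succ x) ∂ν := by
    intro k
    have h1 : (fun x => M.mixedEpistemic
        (![uniformPreparation hd' (B 0), uniformPreparation hd' (B k.succ)] x)) =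
        fun x => ν.withDensity (F (![0, k.succ] x)) := by
      funext x
      fin_cases x <;> simp [hmix]
    rw [h1, commonOverlap_withDensity ν (fun x => F (![0, k.succ] x)) (fun x => hF _)
      (fun x => by rw [hF1]; exact ENNReal.one_ne_top)]
    refine lintegral_congr fun x => ?_
    refine le_antisymm (le_min (iInf_le _ (0 : Fin 2)) (iInf_le _ (1 : Fin 2))) (le_iInf fun i => ?_)
    fin_cases i
    · exact min_le_left _ _
    · exact min_le_right _ _
  have htriple : ∀ i : Fin d, ∀ k k' : Fin d, k ≠ k' → ∀ j j' : Fin d,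
      ∀ᵐ x ∂ν, f 0 i x = 0 ∨ f k.succ j x = 0 ∨ f k'.succ j' x = 0 := by
    intro i k k' hk j j'
    let a : Fin 3 → Fin (d + 1) := ![0, k.succ, k'.succ]
    let l : Fin 3 → Fin d := ![i, j, j']
    have ha : Function.Injective a := by
      have hk' := hk.symm
      intro s t hst
      fin_cases s <;> fin_cases t <;>
        simp_all [a, Fin.succ_ne_zero, (Fin.succ_ne_zero _).symm]
    obtain ⟨E, hE⟩ := exists_antidistinguishing_povm hd (fun s => ψ (a s) (l s))
      fun s t hst => hB (ha.ne hst) (l s) (l t)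
    filter_upwards [M.ae_exists_density_eq_zero _ E hE ν (fun s => f (a s) (l s))
      (fun s => hf _ _) fun s => hν _ _] with x hx
    obtain ⟨s, hs⟩ := hx
    fin_cases s
    · exact .inl hs
    · exact .inr (.inl hs)
    · exact .inr (.inr hs)
  -- There are finitely many triples, so a single null set serves them all.
  have hall : ∀ᵐ x ∂ν, ∀ i : Fin d, ∀ k k' : Fin d, k ≠ k' → ∀ j j' : Fin d,
      f 0 i x = 0 ∨ f k.succ j x = 0 ∨ f k'.succ j' x = 0 := by
    simp only [ae_all_iff]
    exact htriple
  simp only [hov]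
  rw [← lintegral_finsetSum _ fun k _ => (hF 0).min (hF k.succ), ← hF1 0]
  refine lintegral_mono_ae ?_
  filter_upwards [hall] with x hx
  refine sum_min_le_of_pairwise (F 0 x) (fun k : Fin d => F k.succ x) fun k k' hk => ?_
  have hex : ∀ a, F a x ≠ 0 → ∃ i, f a i x ≠ 0 := by
    intro a hne
    by_contra! h0
    exact hne (Finset.sum_eq_zero fun i _ => by simp [h0 i])
  by_contra! hne
  obtain ⟨i, hi⟩ := hex _ hne.1
  obtain ⟨j, hj⟩ := hex _ hne.2.1
  obtain ⟨j', hj'⟩ := hex _ hne.2.2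
  rcases hx i k k' hk j j' with h | h | h
  · exact hi h
  · exact hj h
  · exact hj' h

theorem sum_epistemicOverlap_le_one {d : ℕ} (hd : 4 ≤ d)
    (B : Fin (d + 1) → OrthonormalBasis (Fin d) ℂ (EuclideanSpace ℂ (Fin d)))
    (hB : Pairwise fun a b => MutuallyUnbiased (B a) (B b)) (M : OntologicalModel.{u} d)
    (hd' : 0 < d) :
    ∑ k : Fin d, M.epistemicOverlap
      ![uniformPreparation hd' (B 0), uniformPreparation hd' (B k.succ)] ≤ 1 := by
  have h := sum_commonOverlap_le_one hd B hB M hd'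
  have hne := ENNReal.sum_ne_top.1 (h.trans_lt ENNReal.one_lt_top).ne
  simp only [OntologicalModel.epistemicOverlap]
  rw [← ENNReal.toReal_sum hne]
  exact ENNReal.toReal_le_of_le_ofReal zero_le_one (by simpa using h)

/-- Used to refute noncontextuality: it would force overlap `1` where the bound gives less. -/
theorem epistemicOverlap_eq_one_of_eq {d : ℕ} (M : OntologicalModel.{u} d)
    (P Q : MixedPreparation d) (h : M.mixedEpistemic P = M.mixedEpistemic Q) :
    M.epistemicOverlap ![P, Q] = 1 := by
  have := M.isProbabilityMeasure_mixedEpistemic Q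
  have h1 : (fun x => M.mixedEpistemic (![P, Q] x)) =
      fun _ : Fin 2 => (M.mixedEpistemic Q).withDensity fun _ => 1 := by
    funext x
    fin_cases x <;> simp [h]
  rw [OntologicalModel.epistemicOverlap, h1, commonOverlap_withDensity _ _
    (fun _ => measurable_const) (by simp)]
  simp

theorem exists_epistemicOverlap_le {d : ℕ} (hd : 4 ≤ d)
    (B : Fin (d + 1) → OrthonormalBasis (Fin d) ℂ (EuclideanSpace ℂ (Fin d)))
    (hB : Pairwise fun a b => MutuallyUnbiased (B a) (B b)) (M : OntologicalModel.{u} d)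
    (hd' : 0 < d) :
    ∃ k : Fin d, M.epistemicOverlap
      ![uniformPreparation hd' (B 0), uniformPreparation hd' (B k.succ)] ≤ 1 / (d : ℝ) := by
  have : NeZero d := ⟨hd'.ne'⟩
  have hdne : (d : ℝ) ≠ 0 := by exact_mod_cast hd'.ne'
  obtain ⟨k, -, hk⟩ := Finset.exists_le_of_sum_le (s := (Finset.univ : Finset (Fin d)))
    (g := fun _ => 1 / (d : ℝ)) Finset.univ_nonempty
    ((sum_epistemicOverlap_le_one hd B hB M hd').trans (by simp [hdne]))
  exact ⟨k, hk⟩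

end Quantum

open Quantum in
theorem mainTheorem7 :
    (∀ (d : ℕ) (hd : 4 ≤ d), IsPrimePow d →
      ∀ B : Fin (d + 1) → OrthonormalBasis (Fin d) ℂ (EuclideanSpace ℂ (Fin d)),
      Pairwise (fun a b => MutuallyUnbiased (B a) (B b)) →
      ∀ ρ : Fin (d + 1) → MixedPreparation d,
      (∀ a, ρ a = uniformPreparation (by omega) (B a)) →
      (∀ a, (ρ a).density = (1 / (d : ℂ)) • (1 : Matrix (Fin d) (Fin d) ℂ)) ∧
      (∀ k : Fin d, quantumOverlap ![ρ 0, ρ k.succ] = 1) ∧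
      ∀ M : OntologicalModel.{u} d,
        (1 / (d : ℝ)) * ∑ k : Fin d,
          M.epistemicOverlap ![ρ 0, ρ k.succ] / quantumOverlap ![ρ 0, ρ k.succ] ≤ 1 / (d : ℝ) ∧
        (∃ k : Fin d, quantumOverlap ![ρ 0, ρ k.succ] = 1 ∧
          M.epistemicOverlap ![ρ 0, ρ k.succ] < 1) ∧
        ¬ M.IsPreparationNoncontextual) ∧
    (∀ (d : ℕ → ℕ) (hd : ∀ n, 4 ≤ d n), (∀ n, IsPrimePow (d n)) →
      Filter.Tendsto d Filter.atTop Filter.atTop →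
      ∀ B : ∀ n, Fin (d n + 1) →
        OrthonormalBasis (Fin (d n)) ℂ (EuclideanSpace ℂ (Fin (d n))),
      (∀ n, Pairwise (fun a b => MutuallyUnbiased (B n a) (B n b))) →
      ∀ ρ : ∀ n, Fin (d n + 1) → MixedPreparation (d n),
      (∀ n a, ρ n a = uniformPreparation (by have := hd n; omega) (B n a)) →
      ∀ M : ∀ n, OntologicalModel.{u} (d n),
      ∃ k : ∀ n, Fin (d n),
        (∀ n, quantumOverlap ![ρ n 0, ρ n (k n).succ] = 1) ∧
        Filter.Tendsto (fun n => (M n).epistemicOverlap ![ρ n 0, ρ n (k n).succ])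
          Filter.atTop (nhds 0) ∧
        Filter.Tendsto (fun n => (M n).epistemicOverlap ![ρ n 0, ρ n (k n).succ] /
            quantumOverlap ![ρ n 0, ρ n (k n).succ])
          Filter.atTop (nhds 0)) := by
  constructor
  · intro d hd _ B hB ρ hρ
    obtain rfl : ρ = fun a => uniformPreparation (by omega) (B a) := funext hρ
    have hd' : 0 < d := by omega
    have hQ : ∀ k : Fin d, quantumOverlap
        ![uniformPreparation hd' (B 0), uniformPreparation hd' (B k.succ)] = 1 :=
      fun k => quantumOverlap_uniformPreparation hd' _ _
    refine ⟨fun a => uniformPreparation_density _ _, hQ, fun M => ?_⟩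
    obtain ⟨k, hk⟩ := exists_epistemicOverlap_le hd B hB M hd'
    have hlt : M.epistemicOverlap
        ![uniformPreparation hd' (B 0), uniformPreparation hd' (B k.succ)] < 1 := by
      refine hk.trans_lt ?_
      rw [div_lt_one (by exact_mod_cast hd')]
      exact_mod_cast (by omega : 1 < d)
    refine ⟨?_, ⟨k, hQ k, hlt⟩, fun hM => ?_⟩
    · simp only [hQ, div_one]
      exact mul_le_of_le_one_right (by positivity) (sum_epistemicOverlap_le_one hd B hB M hd')
    · exact hlt.ne (epistemicOverlap_eq_one_of_eq M _ _ (hM _ _ (hQ k)))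
  · intro d hd _ hlim B hB ρ hρ M
    obtain rfl : ρ = fun n a => uniformPreparation (by have := hd n; omega) (B n a) :=
      funext fun n => funext (hρ n)
    have hd' : ∀ n, 0 < d n := fun n => by have := hd n; omega
    choose k hk using fun n => exists_epistemicOverlap_le (hd n) (B n) (hB n) (M n) (hd' n)
    have hQ : ∀ n, quantumOverlap ![uniformPreparation (hd' n) (B n 0),
        uniformPreparation (hd' n) (B n (k n).succ)] = 1 :=
      fun n => quantumOverlap_uniformPreparation (hd' n) _ _
    have hT : Filter.Tendsto (fun n => (M n).epistemicOverlap ![uniformPreparation (hd' n) (B n 0),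
        uniformPreparation (hd' n) (B n (k n).succ)]) Filter.atTop (nhds 0) :=
      -- The overlap at the chosen index lies between `0` and `1 / d n`.
      squeeze_zero (fun n => ENNReal.toReal_nonneg) hk
        (tendsto_one_div_atTop_nhds_zero_nat.comp hlim)
    refine ⟨k, hQ, hT, ?_⟩
    simp only [hQ, div_one]
    exact hT
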